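/- Let $X$ be a complex Banach space, $T:[0,\infty)\to B(X)$ a $C_0$-semigroup and $A:D(A)\subseteq X\to X$ its infinitesimal generator. Let $L^1_s(\mathbb R,B(X))$ be the set of all $K:\mathbb R\to B(X)$ such that $s\mapsto K(s)v$ is (Bochner) measurable for every $v\in X$ and $\|K(s)\|\le f(s)$ a.e. for some $f\in L^1(\mathbb R)$; let $\|K\|_1$ be the infimum of $\|f\|_1$ over all such $f$. Let $\mathcal F=\mathcal F(\mathbb R,X)$ be a homogeneous Banach function space, that is, a complex Banach space of (a.e. classes of) measurable functions $\mathbb R\to X$ such that 1. $\mathcal F$ is continuously embedded in the Stepanov space $\mathcal S^1$, normed by $\|x\|_{\mathcal S^1}=\sup_{t\in\mathbb R}\int_0^1\|x(s+t)\|\,ds$; 2. for $x\in\mathcal F$ and $t\in\mathbb R$, the translate $s\mapsto x(t+s)$ belongs to $\mathcal F$ and has the same norm as $x$; 3. for $x\in\mathcal F$ and $C\in B(X)$, the function $y(t)=C(x(t))$ belongs to $\mathcal F$ and $\|y\|\le\|C\|\,\|x\|$; 4. for $x\in\mathcal F$ and $K\in L^1_s(\mathbb R,B(X))$, the convolution $(K*x)(t)=\int_{\mathbb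 R}K(s)x(t-s)\,ds$ belongs to $\mathcal F$ and $\|K*x\|\le\|K\|_1\|x\|$; 5. if $x\in\mathcal F$ and $f*x=0$ for all $f\in L^1(\mathbb R)$, then $x=0$. The operator $\mathscr L_{\mathcal F}=-d/dt+A$ on $\mathcal F$ is defined as follows: $x\in D(\mathscr L_{\mathcal F})$ and $\mathscr L_{\mathcal F}x=y$ if $x,y\in\mathcal F$ and (for a suitable representative of $x$) $$x(t)=T(t-s)x(s)-\int_s^tT(t-\tau)y(\tau)\,d\tau\qquad\text{for all } s\le t \text{ in } \mathbb R.$$ The Beurling spectrum of $x\in\mathcal F$ is $$\Lambda(x)=\mathbb R\setminus\{\lambda\in\mathbb R:\ \text{there is } f\in L^1(\mathbb R) \text{ with } \hat f(\lambda)\ne0 \text{ and } f*x=0\},\qquad \hat f(\lambda)=\int_{\mathbb R}f(t)e^{-it\lambda}\,dt.$$ Then: (a) if $x\in\ker\mathscr L_{\mathcal F}$, then $i\Lambda(x)\subseteq\sigma(A)\cap i\mathbb R$; (b) consequently, if $\sigma(A)\cap i\mathbb R=\emptyset$, then $\mathscr L_{\mathcal F}$ is injective. -/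

import Mathlib

open MeasureTheory Filter Topology
open scoped NNReal ENNReal

noncomputable section

namespace AbstractParabolic

/-! ### Semigroups, generators and spectra of unbounded operators -/

/-- A `C₀`-semigroup of bounded operators on a complex normed space `X`. -/
structure C0Semigroup (X : Type*) [NormedAddCommGroup X] [NormedSpace ℂ X] where
  /-- The operators `T(t)`, `t ≥ 0`. -/
  op : ℝ≥0 → X →L[ℂ] X
  op_zero : op 0 = ContinuousLinearMap.id ℂ X
  op_add : ∀ s t : ℝ≥0, op (s + t) = (op s).comp (op t)
  continuous_orbit : ∀ x : X, Continuous fun t : ℝ≥0 => op t x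

section Generator

variable {X : Type*} [NormedAddCommGroup X] [NormedSpace ℂ X]

/-- The right derivative at `0` of the orbit `t ↦ T(t)x` exists and equals `y`. -/
def C0Semigroup.HasGeneratorAt (T : C0Semigroup X) (x y : X) : Prop :=
  Tendsto (fun h : ℝ => ((h : ℂ)⁻¹) • (T.op h.toNNReal x - x)) (𝓝[>] (0 : ℝ)) (𝓝 y)

theorem C0Semigroup.HasGeneratorAt.add {T : C0Semigroup X} {x x' y y' : X}
    (h : T.HasGeneratorAt x y) (h' : T.HasGeneratorAt x' y') :
    T.HasGeneratorAt (x + x') (y + y') := by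
  have := Tendsto.add h h'
  refine this.congr fun r => ?_
  rw [← smul_add, map_add]
  congr 1
  abel

theorem C0Semigroup.HasGeneratorAt.smul {T : C0Semigroup X} {x y : X}
    (c : ℂ) (h : T.HasGeneratorAt x y) : T.HasGeneratorAt (c • x) (c • y) := by
  have := Tendsto.const_smul h c
  refine this.congr fun r => ?_
  rw [smul_comm, smul_sub, map_smul]

theorem C0Semigroup.HasGeneratorAt.zero (T : C0Semigroup X) : T.HasGeneratorAt 0 0 := by
  simp [C0Semigroup.HasGeneratorAt]

theorem C0Semigroup.HasGeneratorAt.unique {T : C0Semigroup X} {x y y' : X}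
    (h : T.HasGeneratorAt x y) (h' : T.HasGeneratorAt x y') : y = y' :=
  tendsto_nhds_unique h h'

/-- The infinitesimal generator `A : D(A) ⊆ X → X` of a `C₀`-semigroup `T`:
`D(A)` is the set of all `x` for which `lim_{h → 0+} (T(h)x - x)/h` exists, and `A x` is that
limit. -/
def C0Semigroup.generator (T : C0Semigroup X) : X →ₗ.[ℂ] X where
  domain :=
    { carrier := {x | ∃ y, T.HasGeneratorAt x y}
      add_mem' := fun ⟨y, hy⟩ ⟨y', hy'⟩ => ⟨y + y', hy.add hy'⟩
      zero_mem' := ⟨0, C0Semigroup.HasGeneratorAt.zero T⟩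
      smul_mem' := fun c _ ⟨y, hy⟩ => ⟨c • y, hy.smul c⟩ }
  toFun :=
    { toFun := fun x => Classical.choose x.2
      map_add' := fun x x' => (Classical.choose_spec (x + x').2).unique
        ((Classical.choose_spec x.2).add (Classical.choose_spec x'.2))
      map_smul' := fun c x => (Classical.choose_spec (c • x).2).unique
        ((Classical.choose_spec x.2).smul c) }

theorem C0Semigroup.generator_spec (T : C0Semigroup X) (x : T.generator.domain) :
    T.HasGeneratorAt (x : X) (T.generator x) :=
  Classical.choose_spec x.2

/-- The resolvent set `ρ(A)` of an unbounded operator `A : D(A) ⊆ X → X`: the set of all `z` such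
that `z - A : D(A) → X` is a bijection with a bounded inverse `R`. -/
def unboundedResolventSet (A : X →ₗ.[ℂ] X) : Set ℂ :=
  {z | ∃ R : X →L[ℂ] X,
    (∀ y : X, ∃ h : R y ∈ A.domain, z • R y - A ⟨R y, h⟩ = y) ∧
    ∀ x : A.domain, R (z • (x : X) - A x) = x}

/-- The spectrum `σ(A)` of an unbounded operator. -/
def unboundedSpectrum (A : X →ₗ.[ℂ] X) : Set ℂ := (unboundedResolventSet A)ᶜ

end Generator

/-! ### Homogeneous Banach function spaces

A Banach function space is a complex Banach space `F` together with a linear map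
`ι : F → L⁰(ℝ, X)` realising its elements as (Lebesgue-a.e. classes of) strongly measurable
functions; the injectivity of `ι` is part of the definition of a homogeneous space below. -/

section Homogeneous

variable {X : Type*} [NormedAddCommGroup X] [NormedSpace ℂ X]

/-- The Stepanov norm `‖u‖_{S¹} = sup_t ∫₀¹ ‖u(s + t)‖ ds`, with values in `[0, ∞]`. -/
def stepanovNorm (u : ℝ → X) : ℝ≥0∞ :=
  ⨆ t : ℝ, ∫⁻ s in Set.Icc (0 : ℝ) 1, ‖u (s + t)‖ₑ

/-- `f` is an integrable majorant of the operator-valued function `K`. -/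
def IsL1Majorant (K : ℝ → X →L[ℂ] X) (f : ℝ → ℝ) : Prop :=
  Integrable f ∧ ∀ᵐ s, ‖K s‖ ≤ f s

/-- The space `L¹_s(ℝ, B(X))`: all `K : ℝ → B(X)` for which every `s ↦ K(s)x` is (Bochner)
measurable and `‖K(·)‖` has an integrable majorant. -/
def MemL1s (K : ℝ → X →L[ℂ] X) : Prop :=
  (∀ x : X, AEStronglyMeasurable (fun s => K s x) volume) ∧ ∃ f : ℝ → ℝ, IsL1Majorant K f

/-- The norm of `L¹_s(ℝ, B(X))`: the infimum of the `L¹`-norms of the integrable majorants. -/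
def l1sNorm (K : ℝ → X →L[ℂ] X) : ℝ :=
  sInf {r : ℝ | ∃ f : ℝ → ℝ, IsL1Majorant K f ∧ r = ∫ s, |f s|}

/-- The convolution `(K * u)(t) = ∫ K(s) u(t - s) ds` with an operator-valued kernel. -/
def opConv (K : ℝ → X →L[ℂ] X) (u : ℝ → X) (t : ℝ) : X := ∫ s, K s (u (t - s))

/-- The convolution `(f * u)(t) = ∫ f(s) u(t - s) ds` with a scalar kernel. -/
def scalarConv (f : ℝ → ℂ) (u : ℝ → X) (t : ℝ) : X := ∫ s, f s • u (t - s)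

variable {F : Type*} [NormedAddCommGroup F] [NormedSpace ℂ F]

/-- The normed function space `ι : F → L⁰(ℝ, X)` is homogeneous. -/
structure IsHomogeneous (ι : F →ₗ[ℂ] (ℝ →ₘ[volume] X)) : Prop where
  /-- Elements of `F` are determined by the functions they represent. -/
  injective : Function.Injective ι
  /-- `F` is continuously embedded into the Stepanov space `S¹`. -/
  stepanov : ∃ C : ℝ≥0, ∀ x : F, stepanovNorm (ι x) ≤ C * ‖x‖ₑ
  /-- `F` is translation invariant and the translations are isometries. -/
  translation : ∀ (t : ℝ) (x : F), ∃ y : F,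
    (ι y =ᵐ[volume] fun s => ι x (t + s)) ∧ ‖y‖ = ‖x‖
  /-- `F` is invariant under pointwise application of bounded operators on `X`. -/
  pointwise : ∀ (C : X →L[ℂ] X) (x : F), ∃ y : F,
    (ι y =ᵐ[volume] fun t => C (ι x t)) ∧ ‖y‖ ≤ ‖C‖ * ‖x‖
  /-- `F` is invariant under convolution with kernels from `L¹_s(ℝ, B(X))`. -/
  convolution : ∀ (K : ℝ → X →L[ℂ] X), MemL1s K → ∀ x : F, ∃ y : F,
    (ι y =ᵐ[volume] opConv K (ι x)) ∧ ‖y‖ ≤ l1sNorm K * ‖x‖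
  /-- The `L¹(ℝ)`-module `F` is non-degenerate. -/
  nondegenerate : ∀ x : F,
    (∀ f : ℝ → ℂ, Integrable f → scalarConv f (ι x) =ᵐ[volume] 0) → x = 0

/-- The Fourier transform `f̂(λ) = ∫ f(t) e^{-itλ} dt`. -/
def fourierL1 (f : ℝ → ℂ) (l : ℝ) : ℂ := ∫ t, f t * Complex.exp (-(Complex.I * t * l))

/-- The Beurling spectrum `Λ(x)` of an element `x` of the `L¹(ℝ)`-module `F` (the module structure
being convolution): its complement consists of all `λ` for which there is `f ∈ L¹(ℝ)` with
`f̂(λ) ≠ 0` and `f * x = 0`. -/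
def beurlingSpectrum (ι : F →ₗ[ℂ] (ℝ →ₘ[volume] X)) (x : F) : Set ℝ :=
  {l : ℝ | ∃ f : ℝ → ℂ, Integrable f ∧ fourierL1 f l ≠ 0 ∧
    scalarConv f (ι x) =ᵐ[volume] 0}ᶜ

/-- The abstract parabolic operator `ℒ = -d/dt + A` on `F`, given by its graph:
`x ∈ D(ℒ)` and `ℒ x = y` if the class `x` has a representative `u` such that
`u(t) = T(t-s)u(s) - ∫_s^t T(t-τ)y(τ) dτ` for all `s ≤ t`. -/
def parabolicGraph (T : C0Semigroup X) (ι : F →ₗ[ℂ] (ℝ →ₘ[volume] X)) : Set (F × F) :=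
  {p | ∃ u : ℝ → X, u =ᵐ[volume] ι p.1 ∧ ∀ s t : ℝ, s ≤ t →
    u t = T.op (t - s).toNNReal (u s) - ∫ τ in s..t, T.op (t - τ).toNNReal (ι p.2 τ)}

/-- The kernel of `ℒ`: all `x ∈ D(ℒ)` with `ℒ x = 0`. -/
def parabolicKer (T : C0Semigroup X) (ι : F →ₗ[ℂ] (ℝ →ₘ[volume] X)) : Set F :=
  {x | (x, 0) ∈ parabolicGraph T ι}

/-- Injectivity of `ℒ`: the kernel is trivial and `ℒ x₁ = ℒ x₂` implies `x₁ = x₂`. -/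
def ParabolicInjective (T : C0Semigroup X) (ι : F →ₗ[ℂ] (ℝ →ₘ[volume] X)) : Prop :=
  parabolicKer T ι = {0} ∧
    ∀ x₁ x₂ y : F, (x₁, y) ∈ parabolicGraph T ι → (x₂, y) ∈ parabolicGraph T ι → x₁ = x₂

end Homogeneous

end AbstractParabolic

end

/-! An element of the kernel is represented by a function `u` with `u (t + h) = T(h) u(t)`. Such a
trajectory is continuous, and bounded because it is Stepanov bounded; convolving it with an L¹
kernel gives another bounded trajectory.

Let `z = 2πil` be in the resolvent set, with resolvent `R`, and let `w = 𝓕⁻ k * u` with `k`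
supported near `l`. If `𝓕 f = 1` on the support of `k`, then `w = f * w`, so `w' = f' * w`. Since
`w` is a trajectory, also `w' = A w`, whence `w = R ((z f - f') * w)`. For `f` the modulation of a
dilate `ε φ(ε ·)`, the norm `‖z f - f'‖₁` is `ε ‖φ'‖₁`; for small `ε` the right side contracts the
sup norm and `w = 0` (`IsBoundedTrajectory.exists_ball_scalarConv_eq_zero`). Choosing `k l = 1`
removes the frequency from the Beurling spectrum, which is (a).

For (b), a partition of unity extends the vanishing of `𝓕⁻ k * u` to all compactly supported `k`
(`scalarConv_fourierInv_eq_zero_of_locally`), and an approximate identity made of such kernels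
recovers `u = 0` (`eq_zero_of_scalarConv_fourierInv_eq_zero`). -/

noncomputable section

namespace AbstractParabolic

/-! ### Bounded complete trajectories and the resolvent contraction -/

section Trajectories

variable {X : Type*} [NormedAddCommGroup X] [NormedSpace ℂ X]

/-- A `C₀`-semigroup is uniformly bounded on `[0, 1]`. -/
theorem C0Semigroup.exists_norm_le [CompleteSpace X] (T : C0Semigroup X) :
    ∃ M : ℝ, ∀ t : ℝ≥0, t ≤ 1 → ‖T.op t‖ ≤ M := by
  obtain ⟨M, hM⟩ := banach_steinhaus (g := fun t : Set.Iic (1 : ℝ≥0) => T.op t) (fun x => by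
    have hc : IsCompact (Set.Iic (1 : ℝ≥0)) := by
      have : Set.Iic (1 : ℝ≥0) = Set.Icc 0 1 := by ext; simp
      rw [this]; exact isCompact_Icc
    obtain ⟨C, hC⟩ := hc.exists_bound_of_continuousOn (T.continuous_orbit x).continuousOn
    exact ⟨C, fun i => hC i i.2⟩)
  exact ⟨M, fun t ht => hM ⟨t, ht⟩⟩

/-- `u` is a bounded complete trajectory of the semigroup `T`: a bounded continuous function on the
line with `u (t + h) = T(h) u(t)` for all `t` and all `h ≥ 0`. -/
structure IsBoundedTrajectory (T : C0Semigroup X) (u : ℝ → X) : Prop where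
  continuous : Continuous u
  bounded : ∃ C : ℝ, ∀ t, ‖u t‖ ≤ C
  apply_add : ∀ (t : ℝ) (h : ℝ≥0), u (t + h) = T.op h (u t)

/-- Near `t` the function coincides with the orbit of `u (t - 1)`, and orbits are continuous.
Starting strictly before `t` gives continuity from both sides. -/
theorem continuous_of_apply_add {T : C0Semigroup X} {u : ℝ → X}
    (hu : ∀ (t : ℝ) (h : ℝ≥0), u (t + h) = T.op h (u t)) : Continuous u := by
  rw [continuous_iff_continuousAt]
  intro t
  have hc : Continuous fun r : ℝ => T.op (r - (t - 1)).toNNReal (u (t - 1)) :=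
    (T.continuous_orbit _).comp (by fun_prop)
  refine hc.continuousAt.congr ?_
  filter_upwards [Ioi_mem_nhds (show t - 1 < t by linarith)] with r hr
  rw [← hu, Real.coe_toNNReal _ (sub_nonneg.2 (le_of_lt hr))]
  congr 1
  ring

/-- A Stepanov bounded trajectory is bounded. -/
theorem exists_norm_le_of_stepanovNorm_lt_top [CompleteSpace X] {T : C0Semigroup X} {u : ℝ → X}
    (hu : ∀ (t : ℝ) (h : ℝ≥0), u (t + h) = T.op h (u t)) (hS : stepanovNorm u < ∞) :
    ∃ C : ℝ, ∀ t, ‖u t‖ ≤ C := by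
  obtain ⟨M, hM⟩ := T.exists_norm_le
  refine ⟨(ENNReal.ofReal M * stepanovNorm u).toReal, fun t => ?_⟩
  have hfin : ENNReal.ofReal M * stepanovNorm u ≠ ∞ := ENNReal.mul_ne_top (by simp) hS.ne
  -- For every `s` in `[0, 1]`, `u t = T(1 - s) u(s + t - 1)`; integrating the resulting bound over
  -- `s` compares the value at a point with a Stepanov integral.
  have key : ‖u t‖ₑ ≤ ENNReal.ofReal M * stepanovNorm u := by
    calc ‖u t‖ₑ = ∫⁻ _ in Set.Icc (0 : ℝ) 1, ‖u t‖ₑ := by simp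
      _ ≤ ∫⁻ s in Set.Icc (0 : ℝ) 1, ENNReal.ofReal M * ‖u (s + (t - 1))‖ₑ := by
        refine setLIntegral_mono' measurableSet_Icc fun s hs => ?_
        have h1 := hu (s + (t - 1)) (1 - s).toNNReal
        rw [Real.coe_toNNReal _ (sub_nonneg.2 hs.2), show s + (t - 1) + (1 - s) = t by ring] at h1
        have h2 : ‖T.op (1 - s).toNNReal‖ ≤ M := hM _ (by
          rw [Real.toNNReal_le_one]; linarith [hs.1])
        rw [h1, ← ofReal_norm, ← ofReal_norm, ← ENNReal.ofReal_mul ((norm_nonneg _).trans h2)]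
        exact ENNReal.ofReal_le_ofReal ((T.op _).le_of_opNorm_le h2 _)
      _ = ENNReal.ofReal M * ∫⁻ s in Set.Icc (0 : ℝ) 1, ‖u (s + (t - 1))‖ₑ :=
        lintegral_const_mul' _ _ (by simp)
      _ ≤ _ := by
        gcongr
        exact le_iSup (fun t : ℝ => ∫⁻ s in Set.Icc (0 : ℝ) 1, ‖u (s + t)‖ₑ) (t - 1)
  rw [← toReal_enorm]
  exact ENNReal.toReal_mono hfin key

theorem stepanovNorm_congr {E : Type*} [NormedAddCommGroup E] {u v : ℝ → E} (h : u =ᵐ[volume] v) :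
    stepanovNorm u = stepanovNorm v := by
  unfold stepanovNorm
  congr! 2 with t
  refine lintegral_congr_ae (ae_restrict_of_ae ?_)
  have := (quasiMeasurePreserving_add_right volume t).ae h
  filter_upwards [this] with s hs
  rw [hs]

theorem scalarConv_congr {u v : ℝ → X} (h : u =ᵐ[volume] v) (f : ℝ → ℂ) :
    scalarConv f u = scalarConv f v := by
  funext t
  refine integral_congr_ae ?_
  have := (quasiMeasurePreserving_sub_left_of_right_invariant volume t).ae h
  filter_upwards [this] with s hs
  simp only [hs]

theorem integrable_smul_comp_sub {u : ℝ → X} (hu : Continuous u) {C : ℝ} (hC : ∀ t, ‖u t‖ ≤ C)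
    {f : ℝ → ℂ} (hf : Integrable f) (t : ℝ) : Integrable fun s => f s • u (t - s) :=
  hf.smul_bdd C (hu.comp (by fun_prop)).aestronglyMeasurable (.of_forall fun s => hC _)

theorem norm_scalarConv_le {u : ℝ → X} {C : ℝ} (hC : ∀ t, ‖u t‖ ≤ C)
    {f : ℝ → ℂ} (hf : Integrable f) (t : ℝ) : ‖scalarConv f u t‖ ≤ (∫ s, ‖f s‖) * C := by
  rw [← integral_mul_const]
  refine norm_integral_le_of_norm_le (hf.norm.mul_const C) (.of_forall fun s => ?_)
  rw [norm_smul]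
  exact mul_le_mul_of_nonneg_left (hC _) (norm_nonneg _)

variable {T : C0Semigroup X} {u : ℝ → X}

/-- The bounded operator `T(h)` passes under the integral sign; continuity then follows from the
trajectory law alone. -/
theorem IsBoundedTrajectory.conv [CompleteSpace X] (hu : IsBoundedTrajectory T u) {f : ℝ → ℂ}
    (hf : Integrable f) : IsBoundedTrajectory T (scalarConv f u) := by
  obtain ⟨C, hC⟩ := hu.bounded
  have h : ∀ (t : ℝ) (h : ℝ≥0),
      scalarConv f u (t + h) = T.op h (scalarConv f u t) := by
    intro t h
    unfold scalarConv
    rw [← (T.op h).integral_comp_comm (integrable_smul_comp_sub hu.continuous hC hf t)]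
    congr 1 with s
    rw [map_smul, ← hu.apply_add]
    congr 2
    ring
  exact ⟨continuous_of_apply_add h, ⟨_, norm_scalarConv_le hC hf⟩, h⟩

theorem aestronglyMeasurable_comp_add_smul {f : ℝ → ℂ} (hf : Continuous f) {u : ℝ → X}
    (hu : Continuous u) (t h : ℝ) :
    AEStronglyMeasurable (fun s => f (s + h) • u (t - s)) volume := by
  have : Continuous fun s => f (s + h) • u (t - s) := by fun_prop
  exact this.aestronglyMeasurable

/-- The quantity `(1 + |s|)⁻²` changes at most by a factor `4` under translations by `|h| ≤ 1`. -/
theorem one_add_abs_rpow_translate {s h : ℝ} (hh : |h| ≤ 1) :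
    (1 + ‖s + h‖) ^ (-2 : ℝ) ≤ 4 * (1 + ‖s‖) ^ (-2 : ℝ) := by
  have h0 : (0 : ℝ) < 1 + ‖s + h‖ := by positivity
  have h1 : (0 : ℝ) < 1 + ‖s‖ := by positivity
  have h2 : 1 + ‖s‖ ≤ 2 * (1 + ‖s + h‖) := by
    have : |s| ≤ |s + h| + |h| := by simpa using abs_sub (s + h) h
    simp only [Real.norm_eq_abs]
    linarith [abs_nonneg (s + h)]
  rw [Real.rpow_neg h0.le, Real.rpow_neg h1.le, Real.rpow_two, Real.rpow_two, ← div_eq_mul_inv,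
    inv_le_comm₀ (by positivity) (by positivity), inv_div, div_le_iff₀ (by norm_num)]
  nlinarith

/-- Differentiation of a convolution falls on the kernel. -/
theorem hasDerivAt_scalarConv (hu : Continuous u) {C : ℝ} (hC : ∀ t, ‖u t‖ ≤ C) {f f' : ℝ → ℂ}
    (hf : Integrable f) (hf' : Continuous f') (hd : ∀ s, HasDerivAt f (f' s) s) {B : ℝ}
    (hB : ∀ s, ‖f' s‖ ≤ B * (1 + ‖s‖) ^ (-2 : ℝ)) (t : ℝ) :
    HasDerivAt (fun h => scalarConv f u (t + h)) (scalarConv f' u t) 0 := by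
  have hfc : Continuous f := continuous_iff_continuousAt.2 fun s => (hd s).continuousAt
  -- A substitution moves the shift from `u`, which need not be differentiable, to the kernel.
  have heq : (fun h => scalarConv f u (t + h)) = fun h => ∫ s, f (s + h) • u (t - s) := by
    funext h
    unfold scalarConv
    rw [← integral_add_right_eq_self _ h]
    congr 1 with s
    congr 2
    ring
  have hC0 : 0 ≤ C := (norm_nonneg _).trans (hC 0)
  have hB0 : 0 ≤ B := by simpa using (norm_nonneg _).trans (hB 0)
  have h := hasDerivAt_integral_of_dominated_loc_of_deriv_le (𝕜 := ℝ) (μ := volume)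
    (F := fun h s => f (s + h) • u (t - s)) (F' := fun h s => f' (s + h) • u (t - s)) (x₀ := 0)
    (s := Metric.ball 0 1) (bound := fun s => B * 4 * (1 + ‖s‖) ^ (-2 : ℝ) * C)
    (Metric.ball_mem_nhds _ one_pos)
    (.of_forall fun h => aestronglyMeasurable_comp_add_smul hfc hu t h)
    (by simpa using integrable_smul_comp_sub hu hC hf t)
    (aestronglyMeasurable_comp_add_smul hf' hu t 0)
    (.of_forall fun s h hh => by
      rw [norm_smul, mul_assoc B]
      have := one_add_abs_rpow_translate (s := s) (h := h) (by simpa using (mem_ball_zero_iff.1 hh).le)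
      exact mul_le_mul ((hB _).trans (mul_le_mul_of_nonneg_left this hB0)) (hC _) (norm_nonneg _)
        (by positivity))
    (((integrable_one_add_norm (by simp)).const_mul _).mul_const _)
    (.of_forall fun s h _ => by
      have := (hd (s + h)).comp_const_add s h
      exact this.smul_const _)
  rw [heq]
  simpa [scalarConv] using h.2

/-- For `r > 0` the quotient `(T(r) u(t) - u(t)) / r` is the slope of `u` between `t` and `t + r`.
-/
theorem IsBoundedTrajectory.hasGeneratorAt_of_hasDerivAt (hu : IsBoundedTrajectory T u) {t : ℝ}
    {y : X} (h : HasDerivAt (fun r => u (t + r)) y 0) : T.HasGeneratorAt (u t) y := by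
  have h1 : HasDerivWithinAt (fun r => u (t + r)) y (Set.Ioi 0) 0 := h.hasDerivWithinAt
  rw [hasDerivWithinAt_iff_tendsto_slope' (by simp)] at h1
  refine h1.congr' ?_
  filter_upwards [self_mem_nhdsWithin] with r hr
  rw [← hu.apply_add, slope_def_module, Real.coe_toNNReal _ (le_of_lt hr)]
  simp only [sub_zero, add_zero]
  rw [← Complex.ofReal_inv, Complex.coe_smul]

theorem eq_apply_of_hasGeneratorAt {z : ℂ} {R : X →L[ℂ] X}
    (hR : ∀ x : T.generator.domain, R (z • (x : X) - T.generator x) = x) {x y : X}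
    (h : T.HasGeneratorAt x y) : x = R (z • x - y) := by
  have := hR ⟨x, y, h⟩
  rwa [(T.generator_spec ⟨x, y, h⟩).unique h, eq_comm] at this

/-- If a kernel `f` reproduces a bounded trajectory `w` and `‖f' - z f‖₁` is small compared to the
norm of the resolvent at `z`, then `w` vanishes. -/
theorem IsBoundedTrajectory.eq_zero_of_scalarConv_eq (hu : IsBoundedTrajectory T u) {z : ℂ}
    {R : X →L[ℂ] X} (hR : ∀ x : T.generator.domain, R (z • (x : X) - T.generator x) = x)
    {f f' : ℝ → ℂ} (hf : Integrable f) (hf' : Continuous f') (hd : ∀ s, HasDerivAt f (f' s) s)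
    {B : ℝ} (hB : ∀ s, ‖f' s‖ ≤ B * (1 + ‖s‖) ^ (-2 : ℝ))
    (hsmall : ‖R‖ * (∫ s, ‖z * f s - f' s‖) < 1) (hrep : scalarConv f u = u) : u = 0 := by
  obtain ⟨C, hC⟩ := hu.bounded
  have hf'i : Integrable f' := by
    refine Integrable.mono' ((integrable_one_add_norm (r := 2) (by simp)).const_mul B)
      hf'.aestronglyMeasurable (.of_forall hB)
  have key : ∀ t, u t = R (scalarConv (fun s => z * f s - f' s) u t) := by
    intro t
    have h1 : T.HasGeneratorAt (u t) (scalarConv f' u t) := by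
      refine hu.hasGeneratorAt_of_hasDerivAt ?_
      have := hasDerivAt_scalarConv hu.continuous hC hf hf' hd hB t
      rwa [hrep] at this
    conv_lhs => rw [eq_apply_of_hasGeneratorAt hR h1]
    congr 1
    conv_lhs => enter [1, 2]; rw [← hrep]
    unfold scalarConv
    rw [← integral_smul, ← integral_sub]
    · simp only [sub_smul, mul_smul]
    · exact (integrable_smul_comp_sub hu.continuous hC hf t).smul z
    · exact integrable_smul_comp_sub hu.continuous hC hf'i t
  set q := ‖R‖ * (∫ s, ‖z * f s - f' s‖) with hq
  have hq0 : 0 ≤ q := mul_nonneg (norm_nonneg _) (integral_nonneg fun _ => norm_nonneg _)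
  -- Any sup bound improves by the factor `q < 1`; iterating it forces `u = 0`.
  have step : ∀ D : ℝ, (∀ t, ‖u t‖ ≤ D) → ∀ t, ‖u t‖ ≤ q * D := by
    intro D hD t
    rw [key t, hq, mul_assoc]
    exact R.le_of_opNorm_le_of_le le_rfl
      (norm_scalarConv_le hD ((hf.const_mul z).sub hf'i) t)
  have hpow : ∀ n : ℕ, ∀ t, ‖u t‖ ≤ q ^ n * C := by
    intro n
    induction n with
    | zero => simpa using hC
    | succ n ih => simpa only [pow_succ', mul_assoc] using step _ ih
  funext t
  have hlim : Tendsto (fun n : ℕ => q ^ n * C) atTop (𝓝 (0 * C)) :=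
    (tendsto_pow_atTop_nhds_zero_of_lt_one hq0 hsmall).mul_const C
  rw [zero_mul] at hlim
  exact norm_le_zero_iff.1 (ge_of_tendsto' hlim fun n => hpow n t)

end Trajectories

/-! ### Reproducing kernels and local vanishing of the spectrum -/

section Kernels

open scoped FourierTransform SchwartzMap

variable {X : Type*} [NormedAddCommGroup X] [NormedSpace ℂ X]

/-- Convolution with scalar kernels is associative. -/
theorem scalarConv_scalarConv [CompleteSpace X] {u : ℝ → X} (hu : Continuous u) {C : ℝ}
    (hC : ∀ t, ‖u t‖ ≤ C) {f g : ℝ → ℂ} (hf : Integrable f) (hg : Integrable g) (t : ℝ) :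
    scalarConv f (scalarConv g u) t = scalarConv (scalarConv f g) u t := by
  have h1 : ∀ x, ConvolutionExistsAt (fun s => ‖g s‖) (fun s => ‖u s‖) x
      (ContinuousLinearMap.mul ℝ ℝ) volume := fun x =>
    hg.norm.mul_bdd (c := C) (hu.norm.comp (by fun_prop)).aestronglyMeasurable
      (.of_forall fun s => by simpa using hC _)
  have hbdd : BddAbove (Set.range fun s => ‖‖u s‖‖) :=
    ⟨C, by rintro _ ⟨s, rfl⟩; simpa using hC s⟩
  -- Associativity rests on Fubini, so the iterated convolution of the norms must also converge:
  -- `‖g‖ * ‖u‖` is continuous and bounded by `‖g‖₁ C`.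
  have hcont := hbdd.continuous_convolution_right_of_integrable (μ := volume)
    (ContinuousLinearMap.mul ℝ ℝ) hg.norm hu.norm
  refine (convolution_assoc (μ := volume) (ν := volume) (ContinuousLinearMap.lsmul ℂ ℂ)
    (ContinuousLinearMap.lsmul ℂ ℂ) (ContinuousLinearMap.lsmul ℂ ℂ)
    (ContinuousLinearMap.lsmul ℂ ℂ) (fun x y z => smul_assoc x y z) hf.aestronglyMeasurable
    hg.aestronglyMeasurable hu.aestronglyMeasurable (hf.ae_convolution_exists _ hg)
    (.of_forall h1) ?_).symm
  refine hf.norm.mul_bdd (c := (∫ s, ‖g s‖) * C) (hcont.comp (by fun_prop)).aestronglyMeasurable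
      (.of_forall fun s => ?_)
  rw [← integral_mul_const]
  refine norm_integral_le_of_norm_le (hg.norm.mul_const C) (.of_forall fun r => ?_)
  simp only [ContinuousLinearMap.mul_apply', norm_mul, norm_norm]
  exact mul_le_mul_of_nonneg_left (hC _) (norm_nonneg _)

theorem exists_schwartzMap_eq_one (c : ℝ) {r : ℝ} (hr : 0 < r) :
    ∃ b : 𝓢(ℝ, ℂ), HasCompactSupport b ∧ Function.support b ⊆ Metric.ball c (2 * r) ∧
      ∀ ξ : ℝ, |ξ - c| ≤ r → b ξ = 1 := by
  let b : ContDiffBump c := ⟨r, 2 * r, hr, by linarith⟩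
  have h1 : HasCompactSupport fun ξ => (b ξ : ℂ) :=
    b.hasCompactSupport.comp_left (g := Complex.ofReal) Complex.ofReal_zero
  have h2 : ContDiff ℝ (⊤ : ℕ∞) fun ξ => (b ξ : ℂ) := Complex.ofRealCLM.contDiff.comp b.contDiff
  refine ⟨h1.toSchwartzMap h2, h1, fun ξ hξ => ?_, fun ξ hξ => ?_⟩
  · have : ξ ∈ Function.support b := by simpa using hξ
    rwa [b.support_eq] at this
  · have : b ξ = 1 := b.one_of_mem_closedBall (by simpa [Real.dist_eq] using hξ)
    simp [this]

/-- The function `s ↦ ε φ(ε s) e^{2π i l s}`, whose Fourier transform is that of `φ`, rescaled by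
`ε` and centred at `l`. -/
def modulatedDilation (φ : ℝ → ℂ) (l ε : ℝ) (s : ℝ) : ℂ :=
  Complex.exp (2 * Real.pi * l * s * Complex.I) * (ε * φ (ε * s))

theorem norm_exp_modulation (l s : ℝ) : ‖Complex.exp (2 * Real.pi * l * s * Complex.I)‖ = 1 := by
  have := Complex.norm_exp_ofReal_mul_I (2 * Real.pi * l * s)
  push_cast at this
  exact this

theorem norm_modulatedDilation (φ : ℝ → ℂ) (l ε s : ℝ) :
    ‖modulatedDilation φ l ε s‖ = |ε| * ‖φ (ε * s)‖ := by
  simp [modulatedDilation, norm_exp_modulation]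

theorem integrable_modulatedDilation {φ : ℝ → ℂ} (hφ : Integrable φ) (l : ℝ) {ε : ℝ}
    (hε : ε ≠ 0) : Integrable (modulatedDilation φ l ε) :=
  ((hφ.comp_mul_left' hε).const_mul (ε : ℂ)).bdd_mul (c := 1)
    (by fun_prop) (.of_forall fun s => (norm_exp_modulation l s).le)

theorem fourier_modulatedDilation (φ : ℝ → ℂ) (l : ℝ) {ε : ℝ} (hε : 0 < ε) (ξ : ℝ) :
    𝓕 (modulatedDilation φ l ε) ξ = 𝓕 φ ((ξ - l) / ε) := by
  rw [Real.fourier_real_eq_integral_exp_smul, Real.fourier_real_eq_integral_exp_smul]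
  have := Measure.integral_comp_mul_left
    (fun v : ℝ => Complex.exp (↑(-2 * Real.pi * v * ((ξ - l) / ε)) * Complex.I) • φ v) ε
  rw [abs_of_pos (inv_pos.2 hε), eq_inv_smul_iff₀ hε.ne', ← integral_smul] at this
  rw [← this]
  congr 1 with s
  simp only [modulatedDilation, smul_eq_mul, Complex.real_smul]
  have hεc : (ε : ℂ) ≠ 0 := by exact_mod_cast hε.ne'
  rw [mul_left_comm (ε : ℂ), ← mul_assoc, ← Complex.exp_add]
  congr 2
  push_cast
  field_simp
  ring

/-- The first term is `z f` with `z = 2πil`; the remainder carries the extra factor `ε` that makes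
`z f - f'` small in L¹. -/
theorem hasDerivAt_modulatedDilation (φ : 𝓢(ℝ, ℂ)) (l ε s : ℝ) :
    HasDerivAt (modulatedDilation φ l ε)
      (2 * Real.pi * l * Complex.I * modulatedDilation φ l ε s +
        ε * modulatedDilation (deriv φ) l ε s) s := by
  have h1 : HasDerivAt (fun s : ℝ => Complex.exp (2 * Real.pi * l * s * Complex.I))
      (Complex.exp (2 * Real.pi * l * s * Complex.I) * (2 * Real.pi * l * Complex.I)) s := by
    have h0 : HasDerivAt (fun s : ℝ => 2 * Real.pi * l * (s : ℂ) * Complex.I)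
        (2 * Real.pi * l * Complex.I) s := by
      simpa using ((Complex.ofRealCLM.hasDerivAt (x := s)).const_mul
        (2 * Real.pi * l : ℂ)).mul_const Complex.I
    exact h0.cexp
  have h2 : HasDerivAt (fun s : ℝ => φ (ε * s)) (ε • deriv φ (ε * s)) s := by
    have h3 : HasDerivAt φ (deriv φ (ε * s)) (ε * s) := φ.differentiableAt.hasDerivAt
    simpa [Function.comp_def] using h3.scomp s ((hasDerivAt_id s).const_mul ε)
  refine (h1.mul (h2.const_mul (ε : ℂ))).congr_deriv ?_
  simp only [modulatedDilation, Complex.real_smul]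
  ring

theorem one_add_abs_rpow_dilate {ε : ℝ} (hε : 0 < ε) (hε1 : ε ≤ 1) (s : ℝ) :
    (1 + ‖ε * s‖) ^ (-2 : ℝ) ≤ ε ^ (-2 : ℝ) * (1 + ‖s‖) ^ (-2 : ℝ) := by
  rw [← Real.mul_rpow hε.le (by positivity)]
  refine Real.rpow_le_rpow_of_nonpos (by positivity) ?_ (by norm_num)
  rw [norm_mul, Real.norm_of_nonneg hε.le]
  nlinarith

theorem exists_norm_schwartzMap_le (φ : 𝓢(ℝ, ℂ)) :
    ∃ B, 0 ≤ B ∧ ∀ s, ‖φ s‖ ≤ B * (1 + ‖s‖) ^ (-2 : ℝ) := by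
  refine ⟨2 ^ 2 * (Finset.Iic (2, 0)).sup (fun m => SchwartzMap.seminorm ℂ m.1 m.2) φ,
    by positivity, fun s => ?_⟩
  · have := SchwartzMap.one_add_le_sup_seminorm_apply (𝕜 := ℂ) (m := (2, 0)) (k := 2) (n := 0)
      le_rfl le_rfl φ s
    rw [norm_iteratedFDeriv_zero, mul_comm] at this
    rw [Real.rpow_neg (by positivity), Real.rpow_two, ← div_eq_mul_inv,
      le_div_iff₀ (by positivity)]
    exact this

/-- The kernel `modulatedDilation φ l ε` reproduces functions with spectrum in the set where its
Fourier transform is `1`. -/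
theorem scalarConv_modulatedDilation {φ : ℝ → ℂ} (hφ : Integrable φ)
    (hφ1 : ∀ ξ : ℝ, |ξ| ≤ 1 → 𝓕 φ ξ = 1) {l ε : ℝ} (hε : 0 < ε) (k : 𝓢(ℝ, ℂ))
    (hk : Function.support k ⊆ Metric.ball l ε) :
    scalarConv (modulatedDilation φ l ε) (𝓕⁻ k : 𝓢(ℝ, ℂ)) = (𝓕⁻ k : 𝓢(ℝ, ℂ)) := by
  set f := modulatedDilation φ l ε with hf
  have hfi : Integrable f := integrable_modulatedDilation hφ l hε.ne'
  funext t
  have hg : ∀ r, (𝓕⁻ k : 𝓢(ℝ, ℂ)) r = ∫ ξ : ℝ, Complex.exp (2 * Real.pi * r * ξ * Complex.I) * k ξ := by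
    intro r
    rw [SchwartzMap.fourierInv_coe, Real.fourierInv_eq']
    congr 1 with ξ
    simp [mul_assoc]
  have hff : ∀ ξ, 𝓕 f ξ = ∫ s : ℝ, f s * Complex.exp (2 * Real.pi * (-s) * ξ * Complex.I) := by
    intro ξ
    rw [Real.fourier_real_eq_integral_exp_smul]
    congr 1 with s
    rw [smul_eq_mul, mul_comm]
    push_cast
    ring_nf
  calc scalarConv f (𝓕⁻ k : 𝓢(ℝ, ℂ)) t
      -- After Fubini the inner integral is `𝓕 f ξ`, so convolution with `f` multiplies `k` by `𝓕
      -- f`, which is `1` wherever `k ξ ≠ 0`.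
      = ∫ s : ℝ, ∫ ξ : ℝ, f s * (Complex.exp (2 * Real.pi * (t - s) * ξ * Complex.I) * k ξ) := by
        unfold scalarConv
        congr 1 with s
        rw [hg, integral_const_mul]
        push_cast
        rfl
    _ = ∫ ξ : ℝ, ∫ s : ℝ, f s * (Complex.exp (2 * Real.pi * (t - s) * ξ * Complex.I) * k ξ) := by
        refine integral_integral_swap ?_
        have hp : Integrable (fun p : ℝ × ℝ => f p.1 * k p.2) (volume.prod volume) :=
          hfi.mul_prod k.integrable
        have := hp.bdd_mul (f := fun p : ℝ × ℝ =>
          Complex.exp (2 * Real.pi * (t - p.1) * p.2 * Complex.I)) (c := 1)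
          (by fun_prop) (.of_forall fun p => by
            have := norm_exp_modulation (t - p.1) p.2
            push_cast at this
            exact this.le)
        refine this.congr (.of_forall fun p => ?_)
        simp only [Function.uncurry]
        ring
    _ = ∫ ξ : ℝ, Complex.exp (2 * Real.pi * t * ξ * Complex.I) * k ξ := by
        congr 1 with ξ
        have : ∀ s : ℝ, f s * (Complex.exp (2 * Real.pi * (t - s) * ξ * Complex.I) * k ξ) =
            f s * Complex.exp (2 * Real.pi * (-s) * ξ * Complex.I) *
              (Complex.exp (2 * Real.pi * t * ξ * Complex.I) * k ξ) := by
          intro s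
          rw [show 2 * Real.pi * (t - s) * ξ * Complex.I = 2 * Real.pi * (-s) * ξ * Complex.I +
            2 * Real.pi * t * ξ * Complex.I by ring, Complex.exp_add]
          ring
        simp_rw [this]
        rw [integral_mul_const, ← hff, hf, fourier_modulatedDilation φ l hε]
        by_cases hξ : k ξ = 0
        · simp [hξ]
        · have := hk hξ
          rw [Metric.mem_ball, Real.dist_eq] at this
          rw [hφ1, one_mul]
          rw [abs_div, abs_of_pos hε, div_le_one hε]
          exact this.le
    _ = _ := (hg t).symm

/-- Near a point `2π i l` of the resolvent set of the generator, a bounded trajectory has no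
spectrum. -/
theorem IsBoundedTrajectory.exists_ball_scalarConv_eq_zero [CompleteSpace X] {T : C0Semigroup X}
    {u : ℝ → X} (hu : IsBoundedTrajectory T u) {l : ℝ}
    (hl : Complex.I * ((2 * Real.pi * l : ℝ) : ℂ) ∈ unboundedResolventSet T.generator) :
    ∃ ε > 0, ∀ k : 𝓢(ℝ, ℂ), Function.support k ⊆ Metric.ball l ε →
      scalarConv (𝓕⁻ k : 𝓢(ℝ, ℂ)) u = 0 := by
  obtain ⟨R, -, hR⟩ := hl
  obtain ⟨b, -, -, hb⟩ := exists_schwartzMap_eq_one 0 one_pos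
  obtain ⟨φ, hφ⟩ : ∃ φ : 𝓢(ℝ, ℂ), 𝓕 φ = b := ⟨𝓕⁻ b, FourierTransform.fourier_fourierInv_eq b⟩
  have hφ1 : ∀ ξ : ℝ, |ξ| ≤ 1 → 𝓕 (φ : ℝ → ℂ) ξ = 1 := by
    intro ξ hξ
    rw [← SchwartzMap.fourier_coe, hφ, hb ξ (by simpa using hξ)]
  set φ' : 𝓢(ℝ, ℂ) := SchwartzMap.derivCLM ℂ ℂ φ with hφ'
  have hφ'd : ⇑φ' = deriv φ := by
    ext s; rw [hφ', SchwartzMap.derivCLM_apply]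
  -- The summand `1` in the denominator of the witness yields both `ε ≤ 1` and the strict
  -- inequality, even when `‖R‖ * ∫ ‖φ'‖` is `0`.
  obtain ⟨ε, hε, hε1, hsm⟩ : ∃ ε : ℝ, 0 < ε ∧ ε ≤ 1 ∧ ‖R‖ * (ε * ∫ s, ‖φ' s‖) < 1 := by
    have h0 : 0 ≤ ‖R‖ * ∫ s, ‖φ' s‖ :=
      mul_nonneg (norm_nonneg _) (integral_nonneg fun _ => norm_nonneg _)
    refine ⟨1 / (‖R‖ * (∫ s, ‖φ' s‖) + 1), by positivity, ?_, ?_⟩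
    · rw [div_le_one (by positivity)]; linarith
    · rw [mul_left_comm, one_div, inv_mul_lt_one₀ (by positivity)]; linarith
  refine ⟨ε, hε, fun k hk => ?_⟩
  have hgi : Integrable (𝓕⁻ k : 𝓢(ℝ, ℂ)) := (𝓕⁻ k : 𝓢(ℝ, ℂ)).integrable
  have hfi := integrable_modulatedDilation φ.integrable l hε.ne'
  obtain ⟨C, hC⟩ := hu.bounded
  obtain ⟨B, hB0, hB⟩ := exists_norm_schwartzMap_le φ
  obtain ⟨B', hB0', hB'⟩ := exists_norm_schwartzMap_le φ'
  have hdil : ∀ (ψ : 𝓢(ℝ, ℂ)) (B : ℝ), 0 ≤ B → (∀ s, ‖ψ s‖ ≤ B * (1 + ‖s‖) ^ (-2 : ℝ)) →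
      ∀ s, ‖modulatedDilation ψ l ε s‖ ≤ ε * (B * ε ^ (-2 : ℝ)) * (1 + ‖s‖) ^ (-2 : ℝ) := by
    intro ψ B hB0 hB s
    rw [norm_modulatedDilation, abs_of_pos hε, mul_assoc, mul_assoc]
    exact mul_le_mul_of_nonneg_left ((hB _).trans
      (mul_le_mul_of_nonneg_left (one_add_abs_rpow_dilate hε hε1 s) hB0)) hε.le
  have hz : ‖(2 * Real.pi * l * Complex.I : ℂ)‖ = 2 * Real.pi * |l| := by
    simp [abs_of_pos Real.pi_pos]
  refine (hu.conv hgi).eq_zero_of_scalarConv_eq hR hfi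
    (f' := fun s => 2 * Real.pi * l * Complex.I * modulatedDilation φ l ε s +
      ε * modulatedDilation φ' l ε s)
    (B := 2 * Real.pi * |l| * (ε * (B * ε ^ (-2 : ℝ))) + ε * (ε * (B' * ε ^ (-2 : ℝ)))) ?_ ?_ ?_ ?_ ?_
  · have := φ.continuous
    have := φ'.continuous
    unfold modulatedDilation
    fun_prop
  · intro s
    rw [hφ'd]
    exact hasDerivAt_modulatedDilation φ l ε s
  · intro s
    refine (norm_add_le _ _).trans ?_
    rw [norm_mul _ (modulatedDilation _ _ _ _), norm_mul (ε : ℂ), hz, Complex.norm_real, Real.norm_of_nonneg hε.le, add_mul,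
      mul_assoc (2 * Real.pi * |l|), mul_assoc ε (ε * _)]
    exact add_le_add
      (mul_le_mul_of_nonneg_left (hdil φ B hB0 hB s) (by positivity))
      (mul_le_mul_of_nonneg_left (hdil φ' B' hB0' hB' s) hε.le)
  · have : ∀ s, ‖Complex.I * ((2 * Real.pi * l : ℝ) : ℂ) * modulatedDilation φ l ε s -
        (2 * Real.pi * l * Complex.I * modulatedDilation φ l ε s +
          ε * modulatedDilation φ' l ε s)‖ = ε * (ε * ‖φ' (ε * s)‖) := by
      intro s
      rw [show Complex.I * ((2 * Real.pi * l : ℝ) : ℂ) * modulatedDilation φ l ε s -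
        (2 * Real.pi * l * Complex.I * modulatedDilation φ l ε s +
          ε * modulatedDilation φ' l ε s) = -(ε * modulatedDilation φ' l ε s) by
            push_cast; ring, norm_neg, norm_mul, norm_modulatedDilation, Complex.norm_real,
            Real.norm_of_nonneg hε.le, abs_of_pos hε]
    simp_rw [this]
    rw [integral_const_mul, integral_const_mul, Measure.integral_comp_mul_left (fun s => ‖φ' s‖),
      abs_of_pos (inv_pos.2 hε), smul_eq_mul, mul_inv_cancel_left₀ hε.ne']
    exact hsm
  · funext t
    rw [scalarConv_scalarConv hu.continuous hC hfi hgi,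
      scalarConv_modulatedDilation φ.integrable hφ1 hε k hk]

end Kernels

/-! ### From local to global vanishing, and the Beurling spectrum -/

section Spectrum

open scoped FourierTransform SchwartzMap Manifold

variable {X : Type*} [NormedAddCommGroup X] [NormedSpace ℂ X]

/-- The factor `2π` reconciles `e^{-itλ}` in `fourierL1` with `e^{-2πisξ}` in `𝓕`. -/
theorem fourierL1_fourierInv (k : 𝓢(ℝ, ℂ)) (l : ℝ) :
    fourierL1 (𝓕⁻ k : 𝓢(ℝ, ℂ)) (2 * Real.pi * l) = k l := by
  conv_rhs => rw [← FourierTransform.fourier_fourierInv_eq (F := 𝓢(ℝ, ℂ)) k]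
  rw [SchwartzMap.fourier_coe, Real.fourier_real_eq_integral_exp_smul, fourierL1]
  congr 1 with s
  rw [smul_eq_mul, mul_comm]
  congr 2
  push_cast
  ring

/-- The local vanishing of the spectrum implies its global vanishing, by a partition of unity. -/
theorem scalarConv_fourierInv_eq_zero_of_locally {u : ℝ → X}
    (hu : Continuous u) {C : ℝ} (hC : ∀ t, ‖u t‖ ≤ C)
    (hloc : ∀ l : ℝ, ∃ ε > 0, ∀ k : 𝓢(ℝ, ℂ), Function.support k ⊆ Metric.ball l ε →
      scalarConv (𝓕⁻ k : 𝓢(ℝ, ℂ)) u = 0) (k : 𝓢(ℝ, ℂ)) (hk : HasCompactSupport k) :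
    scalarConv (𝓕⁻ k : 𝓢(ℝ, ℂ)) u = 0 := by
  choose ε hε hz using hloc
  obtain ⟨ρ, hρ⟩ := SmoothPartitionOfUnity.exists_isSubordinate (I := 𝓘(ℝ, ℝ)) (s := Set.univ)
    isClosed_univ (fun l : ℝ => Metric.ball l (ε l)) (fun _ => Metric.isOpen_ball)
    (fun l _ => Set.mem_iUnion.2 ⟨l, Metric.mem_ball_self (hε l)⟩)
  -- Compactness of the support of `k` leaves finitely many pieces `ρ i * k`, so the decomposition
  -- passes through `𝓕⁻` and the integral as a finite sum.
  have hfin := ρ.locallyFinite.finite_nonempty_inter_compact hk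
  have hcs : ∀ i, HasCompactSupport fun ξ => ((ρ i ξ : ℝ) : ℂ) * k ξ := fun i => hk.mul_left
  have hsm : ∀ i, ContDiff ℝ (⊤ : ℕ∞) fun ξ => ((ρ i ξ : ℝ) : ℂ) * k ξ := fun i =>
    (Complex.ofRealCLM.contDiff.comp (ρ i).contMDiff.contDiff).mul k.smooth'
  let K : ℝ → 𝓢(ℝ, ℂ) := fun i => (hcs i).toSchwartzMap (hsm i)
  have hsum : k = ∑ i ∈ hfin.toFinset, K i := by
    ext ξ
    rw [sum_apply]
    simp only [K, HasCompactSupport.toSchwartzMap_toFun]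
    by_cases hξ : k ξ = 0
    · simp [hξ]
    · have h1 := ρ.sum_finsupport' ξ (Set.mem_univ ξ) (show _ ⊆ hfin.toFinset by
        intro i hi
        rw [ρ.mem_finsupport] at hi
        rw [Set.Finite.mem_toFinset]
        exact ⟨ξ, hi, subset_tsupport _ hξ⟩)
      rw [← Finset.sum_mul, ← Complex.ofReal_sum, h1]
      simp
  have hK : ∀ i, scalarConv (𝓕⁻ (K i) : 𝓢(ℝ, ℂ)) u = 0 := fun i => hz i _ (by
    intro ξ hξ
    refine hρ i (subset_tsupport _ fun h0 => hξ ?_)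
    simp [K, h0])
  have hF : (𝓕⁻ k : 𝓢(ℝ, ℂ)) = ∑ i ∈ hfin.toFinset, 𝓕⁻ (K i) := by
    conv_lhs => rw [hsum]
    exact map_sum (FourierTransform.fourierCLE ℂ 𝓢(ℝ, ℂ)).symm _ _
  funext t
  have : scalarConv (𝓕⁻ k : 𝓢(ℝ, ℂ)) u t =
      ∑ i ∈ hfin.toFinset, scalarConv (𝓕⁻ (K i) : 𝓢(ℝ, ℂ)) u t := by
    unfold scalarConv
    rw [← integral_finsetSum _ fun i _ =>
      integrable_smul_comp_sub hu hC (𝓕⁻ (K i) : 𝓢(ℝ, ℂ)).integrable t, hF]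
    congr 1 with s
    rw [sum_apply, Finset.sum_smul]
  rw [this]
  simp [hK]

/-- A bounded continuous function without spectrum vanishes. -/
theorem eq_zero_of_scalarConv_fourierInv_eq_zero [CompleteSpace X] {u : ℝ → X}
    (hu : Continuous u) {C : ℝ} (hC : ∀ t, ‖u t‖ ≤ C)
    (h0 : ∀ k : 𝓢(ℝ, ℂ), HasCompactSupport k → scalarConv (𝓕⁻ k : 𝓢(ℝ, ℂ)) u = 0) : u = 0 := by
  obtain ⟨b, hbc, -, hb⟩ := exists_schwartzMap_eq_one 0 one_pos
  obtain ⟨φ, hφ⟩ : ∃ φ : 𝓢(ℝ, ℂ), 𝓕 φ = b := ⟨𝓕⁻ b, FourierTransform.fourier_fourierInv_eq b⟩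
  -- The Fourier transform of `n φ(n ·)` is `b(· / n)`, again smooth with compact support; by
  -- Fourier inversion `h0` applies to this kernel.
  have hdil : ∀ n : ℝ, 0 < n → scalarConv (modulatedDilation φ 0 n) u = 0 := by
    intro n hn
    have hcs : HasCompactSupport fun ξ => b (n⁻¹ * ξ) := by
      simpa using hbc.comp_smul (inv_ne_zero hn.ne')
    have hsm : ContDiff ℝ (⊤ : ℕ∞) fun ξ => b (n⁻¹ * ξ) :=
      b.smooth'.comp (contDiff_const.mul contDiff_id)
    have hF : 𝓕 (modulatedDilation φ 0 n) = hcs.toSchwartzMap hsm := by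
      funext ξ
      rw [fourier_modulatedDilation φ 0 hn, ← SchwartzMap.fourier_coe, hφ]
      simp [div_eq_inv_mul]
    have hcont : Continuous (modulatedDilation φ 0 n) := by
      have := φ.continuous
      unfold modulatedDilation
      fun_prop
    have hinv := hcont.fourierInv_fourier_eq
      (integrable_modulatedDilation φ.integrable 0 hn.ne')
      (by rw [hF]; exact SchwartzMap.integrable _)
    rw [hF, ← SchwartzMap.fourierInv_coe] at hinv
    rw [← hinv]
    exact h0 _ hcs
  funext t
  have hint : ∫ s, φ s = 1 := by
    have := congrArg (fun g : 𝓢(ℝ, ℂ) => g 0) hφ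
    simp only [SchwartzMap.fourier_coe, Real.fourier_real_eq_integral_exp_smul] at this
    rw [hb 0 (by simp)] at this
    simpa using this
  -- Up to the substitution `s ↦ (n + 1) s`, these integrals are the vanishing convolutions of
  -- `hdil`; since `∫ φ = b 0 = 1`, their limit is `u t`.
  have hlim : Tendsto (fun n : ℕ => ∫ s, φ s • u (t - ((n : ℝ) + 1)⁻¹ * s)) atTop
      (𝓝 (∫ s, φ s • u t)) := by
    refine tendsto_integral_of_dominated_convergence (fun s => ‖φ s‖ * C) (fun n => ?_)
      (φ.integrable.norm.mul_const C) (fun n => .of_forall fun s => ?_) (.of_forall fun s => ?_)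
    · have := φ.continuous
      exact Continuous.aestronglyMeasurable (by fun_prop)
    · rw [norm_smul]
      exact mul_le_mul_of_nonneg_left (hC _) (norm_nonneg _)
    · refine Tendsto.const_smul ((hu.tendsto t).comp ?_) _
      have h1 : Tendsto (fun n : ℕ => ((n : ℝ) + 1)⁻¹) atTop (𝓝 0) := by
        simpa using tendsto_one_div_add_atTop_nhds_zero_nat (𝕜 := ℝ)
      simpa using (h1.mul_const s).const_sub t
  rw [integral_smul_const, hint, one_smul] at hlim
  refine tendsto_nhds_unique hlim (tendsto_const_nhds.congr fun n => ?_)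
  have hn : (0 : ℝ) < n + 1 := by positivity
  have := congrFun (hdil _ hn) t
  have h2 := Measure.integral_comp_mul_left
    (fun s : ℝ => φ s • u (t - ((n : ℝ) + 1)⁻¹ * s)) ((n : ℝ) + 1)
  rw [abs_of_pos (inv_pos.2 hn), eq_inv_smul_iff₀ hn.ne', ← integral_smul] at h2
  rw [← h2, ← this, scalarConv]
  congr 1 with s
  simp only [modulatedDilation, inv_mul_cancel_left₀ hn.ne']
  simp [← mul_smul, ← Complex.coe_smul]

/-! ### The kernel of the parabolic operator -/

variable {F : Type*} [NormedAddCommGroup F] [NormedSpace ℂ F] {T : C0Semigroup X}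
  {ι : F →ₗ[ℂ] (ℝ →ₘ[volume] X)}

theorem intervalIntegral_op_zero (T : C0Semigroup X) (ι : F →ₗ[ℂ] (ℝ →ₘ[volume] X)) (s t : ℝ) :
    ∫ τ in s..t, T.op (t - τ).toNNReal (ι 0 τ) = 0 := by
  simp

theorem mem_parabolicKer_iff {x : F} : x ∈ parabolicKer T ι ↔
    ∃ u : ℝ → X, u =ᵐ[volume] ι x ∧ ∀ (t : ℝ) (h : ℝ≥0), u (t + h) = T.op h (u t) := by
  simp only [parabolicKer, parabolicGraph, Set.mem_ofPred_eq, intervalIntegral_op_zero, sub_zero]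
  refine exists_congr fun u => and_congr_right fun _ => ⟨fun H t h => ?_, fun H s t hst => ?_⟩
  · simpa using H t (t + h) (by simp)
  · have := H s (t - s).toNNReal
    rwa [Real.coe_toNNReal _ (sub_nonneg.2 hst), add_sub_cancel] at this

/-- Both identities contain the same integral term, which cancels as it stands, so no integrability
of the integrand is needed. -/
theorem sub_mem_parabolicKer {x₁ x₂ y : F} (h₁ : (x₁, y) ∈ parabolicGraph T ι)
    (h₂ : (x₂, y) ∈ parabolicGraph T ι) : x₁ - x₂ ∈ parabolicKer T ι := by
  obtain ⟨u₁, hu₁, H₁⟩ := h₁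
  obtain ⟨u₂, hu₂, H₂⟩ := h₂
  refine ⟨u₁ - u₂, ?_, fun s t hst => ?_⟩
  · rw [map_sub]
    exact (hu₁.sub hu₂).trans (AEEqFun.coeFn_sub _ _).symm
  · rw [intervalIntegral_op_zero, Pi.sub_apply, Pi.sub_apply, H₁ s t hst, H₂ s t hst, map_sub]
    abel

/-- Elements of the kernel of the parabolic operator are represented by bounded trajectories. -/
theorem exists_isBoundedTrajectory_of_mem_parabolicKer [CompleteSpace X] (hF : IsHomogeneous ι)
    {x : F} (hx : x ∈ parabolicKer T ι) :
    ∃ u : ℝ → X, u =ᵐ[volume] ι x ∧ IsBoundedTrajectory T u := by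
  obtain ⟨u, hu, H⟩ := mem_parabolicKer_iff.1 hx
  obtain ⟨C, hC⟩ := hF.stepanov
  refine ⟨u, hu, continuous_of_apply_add H, exists_norm_le_of_stepanovNorm_lt_top H ?_, H⟩
  rw [stepanovNorm_congr hu]
  exact (hC x).trans_lt (ENNReal.mul_lt_top ENNReal.coe_lt_top enorm_lt_top)

theorem notMem_beurlingSpectrum_of_mem_parabolicKer [CompleteSpace X] (hF : IsHomogeneous ι)
    {x : F} (hx : x ∈ parabolicKer T ι) {l : ℝ}
    (hl : Complex.I * (l : ℂ) ∈ unboundedResolventSet T.generator) :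
    l ∉ beurlingSpectrum ι x := by
  obtain ⟨u, hu, H⟩ := exists_isBoundedTrajectory_of_mem_parabolicKer hF hx
  obtain ⟨l, rfl⟩ : ∃ m : ℝ, l = 2 * Real.pi * m :=
    ⟨l / (2 * Real.pi), by field_simp⟩
  obtain ⟨ε, hε, h⟩ := H.exists_ball_scalarConv_eq_zero hl
  -- Radius `ε / 2` makes the bump live in the ball of radius `2 * (ε / 2) = ε` while taking the
  -- value `1` at its centre.
  obtain ⟨b, -, hbs, hb⟩ := exists_schwartzMap_eq_one l (half_pos hε)
  rw [mul_div_cancel₀ ε two_ne_zero] at hbs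
  rw [beurlingSpectrum, Set.notMem_compl_iff]
  refine ⟨_, (𝓕⁻ b : 𝓢(ℝ, ℂ)).integrable, ?_, ?_⟩
  · rw [fourierL1_fourierInv, hb l (by simpa using (half_pos hε).le)]
    exact one_ne_zero
  · rw [← scalarConv_congr hu, h b hbs]

theorem eq_zero_of_mem_parabolicKer [CompleteSpace X] (hF : IsHomogeneous ι)
    (hT : ∀ l : ℝ, Complex.I * (l : ℂ) ∈ unboundedResolventSet T.generator)
    {x : F} (hx : x ∈ parabolicKer T ι) : x = 0 := by
  obtain ⟨u, hu, H⟩ := exists_isBoundedTrajectory_of_mem_parabolicKer hF hx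
  obtain ⟨C, hC⟩ := H.bounded
  have h0 : u = 0 := eq_zero_of_scalarConv_fourierInv_eq_zero H.continuous hC
    (scalarConv_fourierInv_eq_zero_of_locally H.continuous hC fun l =>
      H.exists_ball_scalarConv_eq_zero (hT _))
  refine hF.injective ?_
  rw [map_zero]
  refine AEEqFun.ext (hu.symm.trans ?_)
  rw [h0]
  exact AEEqFun.coeFn_zero.symm

end Spectrum

end AbstractParabolic

end

theorem lemma3p1 {X : Type*} [NormedAddCommGroup X] [NormedSpace ℂ X] [CompleteSpace X]
    (T : AbstractParabolic.C0Semigroup X)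
    {F : Type*} [NormedAddCommGroup F] [NormedSpace ℂ F] [CompleteSpace F]
    (ι : F →ₗ[ℂ] (ℝ →ₘ[volume] X)) (hF : AbstractParabolic.IsHomogeneous ι) :
    (∀ x ∈ AbstractParabolic.parabolicKer T ι,
      (fun l : ℝ => Complex.I * (l : ℂ)) '' AbstractParabolic.beurlingSpectrum ι x ⊆
        AbstractParabolic.unboundedSpectrum T.generator ∩
          Set.range (fun l : ℝ => Complex.I * (l : ℂ))) ∧
    (AbstractParabolic.unboundedSpectrum T.generator ∩
        Set.range (fun l : ℝ => Complex.I * (l : ℂ)) = ∅ →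
      AbstractParabolic.ParabolicInjective T ι) := by
  refine ⟨?_, fun h => ?_⟩
  · rintro x hx _ ⟨l, hl, rfl⟩
    exact ⟨fun hρ =>
      AbstractParabolic.notMem_beurlingSpectrum_of_mem_parabolicKer hF hx hρ hl, l, rfl⟩
  · have hT : ∀ l : ℝ,
        Complex.I * (l : ℂ) ∈ AbstractParabolic.unboundedResolventSet T.generator := by
      intro l
      by_contra hl
      exact (Set.eq_empty_iff_forall_notMem.1 h _) ⟨hl, l, rfl⟩
    refine ⟨Set.eq_singleton_iff_unique_mem.2 ⟨?_, fun x hx =>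
      AbstractParabolic.eq_zero_of_mem_parabolicKer hF hT hx⟩, fun x₁ x₂ y h₁ h₂ => ?_⟩
    · rw [AbstractParabolic.mem_parabolicKer_iff]
      refine ⟨0, ?_, fun t h => by simp⟩
      rw [map_zero]
      exact AEEqFun.coeFn_zero.symm
    · exact sub_eq_zero.1 (AbstractParabolic.eq_zero_of_mem_parabolicKer hF hT
        (AbstractParabolic.sub_mem_parabolicKer h₁ h₂))
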